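/- Let $f,g:\mathbb R^{d_x}\times\mathbb R^{d_y}\to\mathbb R$ (Euclidean norms throughout) and let $\mu>0$, $\bar\sigma>0$, $l_f,L_f,L_g,\rho_f,\rho_g\ge 0$ be such that: (1) for all $0\le\sigma\le\bar\sigma$ and all $x$, the function $h=\sigma f(x,\cdot)+g(x,\cdot)$ attains its minimum $h^*$ and is $\mu$-PL, i.e. $2\mu(h(y)-h^*)\le\|\nabla h(y)\|^2$ for all $y$; (2) $f$ is $l_f$-Lipschitz with $L_f$-Lipschitz gradient; (3) $g$ has an $L_g$-Lipschitz gradient; (4) $f$ and $g$ are twice differentiable with $\rho_f$- resp. $\rho_g$-Lipschitz Hessians. Assume $\mu\le L_g$ (automatic unless $g(x,\cdot)$ is constant for every $x$). For a differentiable $h$, a point $w_0$, $\beta_0>0$ and a tolerance $\tau>0$, AdaGrad-Norm$(h,w_0,\beta_0,\tau)$ iterates, while $\|\nabla h(w^k)\|>\tau$, $\beta_{k+1}^2=\beta_k^2+\|\nabla h(w^k)\|^2$, $w^{k+1}=w^k-\nabla h(w^k)/\beta_{k+1}$ (with $w^0=w_0$); it returns the last point and the number of iterations. Let $a_0,b_0,c_0>0$,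 let $x_0,y_0,z_0$ be arbitrary, let $0<\epsilon\le\min\{1,\bar\sigma\}$ with $\epsilon\rho_f\le\rho_g$, and put $\sigma=\epsilon$, $\epsilon_z=\epsilon_y=\epsilon^2$. Consider the algorithm which for $t=0,1,2,\dots$ runs $(z_t^{K_t},K_t)=$ AdaGrad-Norm$(g(x_t,\cdot),z_t^0,b_0,\epsilon_z)$ and $(y_t^{N_t},N_t)=$ AdaGrad-Norm$(\sigma f(x_t,\cdot)+g(x_t,\cdot),y_t^0,c_0,\epsilon_y)$, where $z_0^0=z_0$, $y_0^0=y_0$ and $z_t^0=z_{t-1}^{K_{t-1}}$, $y_t^0=y_{t-1}^{N_{t-1}}$ for $t\ge1$, and then sets $d_t=\nabla_xf(x_t,y_t^{N_t})+\frac1\sigma\big(\nabla_xg(x_t,y_t^{N_t})-\nabla_xg(x_t,z_t^{K_t})\big)$, $a_{t+1}^2=a_t^2+\|d_t\|^2$, $x_{t+1}=x_t-d_t/a_{t+1}$. Let $\bar C_\sigma\ge0$ be any constant (in particular any constant for which the approximation error bound $\|\nabla\varphi_\sigma(x)-\nabla\varphi(x)\|\le\bar C_\sigma\sigma$ holds,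 where $\varphi(x)=\min\{f(x,y): y\in\operatorname{argmin} g(x,\cdot)\}$ and $\varphi_\sigma(x)=\min_y\{f(x,y)+(g(x,y)-\min_{y'} g(x,y'))/\sigma\}$), put $L_\sigma=L_f+L_g$, $C_\varphi=l_f+\frac{L_gl_f}{\mu}+\bar C_\sigma+\frac{L_f}{\mu}+\frac{2L_g}{\mu}$, $C_b=\max\{L_g,b_0\}$, $C_c=\max\{L_\sigma,c_0\}$, and $$D_z=\frac{L_g^2}{\mu^3}\epsilon_z^2+\frac{L_g^4}{\mu^3a_0^2}C_\varphi^2,\quad b_{\max}=C_b+2\Big(D_z+\frac{L_g}{2}\big(1+\log\tfrac{C_b^2}{b_0^2}\big)\Big),$$ $$D_y=\frac{L_\sigma^2}{\mu^3}\epsilon_y^2+\frac{L_\sigma^4}{\mu^3a_0^2}C_\varphi^2,\quad c_{\max}=C_c+2\Big(D_y+\frac{L_\sigma}{2}\big(1+\log\tfrac{C_c^2}{c_0^2}\big)\Big).$$ Then for every $t$ both inner loops terminate, and for every $t\ge1$ $$K_t\le\frac{\log(C_b^2/b_0^2)}{\log(1+\epsilon_z^2/C_b^2)}+\frac{b_{\max}}{\mu}\log\Big(\frac{L_g^2(b_{\max}-C_b)}{\mu\epsilon_z^2}\Big),$$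 $$N_t\le\frac{\log(C_c^2/c_0^2)}{\log(1+\epsilon_y^2/C_c^2)}+\frac{c_{\max}}{\mu}\log\Big(\frac{L_\sigma^2(c_{\max}-C_c)}{\mu\epsilon_y^2}\Big).$$ For $t=0$ the same bounds hold when $D_z$ is replaced by $\max\{D_z,\,g(x_0,z_0)-\min g(x_0,\cdot)\}$ in $b_{\max}$, and $D_y$ by $\max\{D_y,\,h(y_0)-\min h\}$ with $h=\sigma f(x_0,\cdot)+g(x_0,\cdot)$ in $c_{\max}$. Consequently $K_t=O(1/\epsilon_z^2)$ and $N_t=O(1/\epsilon_y^2)$: there is a constant $M$, depending only on $\mu,l_f,L_f,L_g,\rho_f,\rho_g,\bar\sigma,\bar C_\sigma,a_0,b_0,c_0$, with $K_t\le M/\epsilon_z^2$ and $N_t\le M/\epsilon_y^2$ for all $t\ge1$, and for $t=0$ the same holds with constants which depend, in addition, only on $\|\nabla_yg(x_0,z_0)\|$ (for $K_0$) and $\|\nabla_yg(x_0,y_0)\|$ (for $N_0$). -/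

import Mathlib

noncomputable section

namespace BilevelAdaGrad

/-- The Euclidean space of dimension `d`. -/
abbrev Vec (d : ℕ) : Type := EuclideanSpace ℝ (Fin d)

/-- The product of two Euclidean spaces, with the Euclidean (ℓ²) norm. -/
abbrev Pair (dx dy : ℕ) : Type := WithLp 2 (Vec dx × Vec dy)

/-- A function of two vector variables, as a function on the Euclidean product space. -/
def joint {dx dy : ℕ} (f : Vec dx → Vec dy → ℝ) : Pair dx dy → ℝ :=
  fun p => f p.fst p.snd

/-- The partial gradient in the first variable. -/
def gradX {dx dy : ℕ} (f : Vec dx → Vec dy → ℝ) (x : Vec dx) (y : Vec dy) : Vec dx :=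
  gradient (fun x' => f x' y) x

/-- The penalty function `σ f + g`. -/
def penalty {dx dy : ℕ} (f g : Vec dx → Vec dy → ℝ) (σ : ℝ) : Vec dx → Vec dy → ℝ :=
  fun x y => σ * f x y + g x y

/-- The Polyak-Łojasiewicz condition with constant `μ`: the function has a minimizer, and twice
`μ` times the optimality gap is at most the squared norm of the gradient. -/
def IsPL {d : ℕ} (μ : ℝ) (h : Vec d → ℝ) : Prop :=
  ∃ m : Vec d, (∀ y, h m ≤ h y) ∧ ∀ y, 2 * μ * (h y - h m) ≤ ‖gradient h y‖ ^ 2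

section Lipschitz

variable {E : Type*} [NormedAddCommGroup E] [InnerProductSpace ℝ E] [CompleteSpace E]

/-- `F` is `l`-Lipschitz. -/
def LipFun (l : ℝ) (F : E → ℝ) : Prop :=
  ∀ p q, |F p - F q| ≤ l * ‖p - q‖

/-- `F` is differentiable with an `L`-Lipschitz gradient. -/
def LipGrad (L : ℝ) (F : E → ℝ) : Prop :=
  Differentiable ℝ F ∧ ∀ p q, ‖gradient F p - gradient F q‖ ≤ L * ‖p - q‖

/-- `F` is twice differentiable, and its Hessian (the derivative of the gradient) is
`ρ`-Lipschitz in the operator norm. -/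
def LipHess (ρ : ℝ) (F : E → ℝ) : Prop :=
  Differentiable ℝ F ∧ Differentiable ℝ (gradient F) ∧
    ∀ p q, ‖fderiv ℝ (gradient F) p - fderiv ℝ (gradient F) q‖ ≤ ρ * ‖p - q‖

end Lipschitz

/-- The standing assumptions on the upper-level function `f` and the lower-level function `g`. -/
structure BasicAssumption {dx dy : ℕ} (f g : Vec dx → Vec dy → ℝ)
    (μ lf Lf Lg ρf ρg σbar : ℝ) : Prop where
  pl : ∀ σ, 0 ≤ σ → σ ≤ σbar → ∀ x, IsPL μ (penalty f g σ x)
  lip_f : LipFun lf (joint f)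
  lipGrad_f : LipGrad Lf (joint f)
  lipGrad_g : LipGrad Lg (joint g)
  lipHess_f : LipHess ρf (joint f)
  lipHess_g : LipHess ρg (joint g)

/-! ### The AdaGrad-Norm subroutine -/

/-- One pass of the loop on the pair `(α_k, x^k)`:
`α_{k+1}² = α_k² + ‖∇h(x^k)‖²` and `x^{k+1} = x^k - ∇h(x^k) / α_{k+1}`. -/
def adaStep {d : ℕ} (h : Vec d → ℝ) (s : ℝ × Vec d) : ℝ × Vec d :=
  let a := Real.sqrt (s.1 ^ 2 + ‖gradient h s.2‖ ^ 2)
  (a, s.2 - (1 / a) • gradient h s.2)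

/-- The point `x^k` reached after `k` passes of the loop from `x0`, with initial step-size
parameter `α0`. -/
def adaPoint {d : ℕ} (h : Vec d → ℝ) (x0 : Vec d) (α0 : ℝ) (k : ℕ) : Vec d :=
  ((adaStep h)^[k] (α0, x0)).2

/-- The stopping test of the loop holds after `k` passes. -/
def adaStops {d : ℕ} (h : Vec d → ℝ) (x0 : Vec d) (α0 tol : ℝ) (k : ℕ) : Prop :=
  ‖gradient h (adaPoint h x0 α0 k)‖ ≤ tol

/-- The loop is left after finitely many passes. -/
def adaTerminates {d : ℕ} (h : Vec d → ℝ) (x0 : Vec d) (α0 tol : ℝ) : Prop :=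
  ∃ k, adaStops h x0 α0 tol k

/-- The number of passes of the loop: the first `k` at which the stopping test holds. (It is
meaningful when the loop is left at all, see `adaTerminates`.) -/
def adaCount {d : ℕ} (h : Vec d → ℝ) (x0 : Vec d) (α0 tol : ℝ) : ℕ :=
  sInf {k | adaStops h x0 α0 tol k}

/-- The point returned by the subroutine. -/
def adaOutput {d : ℕ} (h : Vec d → ℝ) (x0 : Vec d) (α0 tol : ℝ) : Vec d :=
  adaPoint h x0 α0 (adaCount h x0 α0 tol)

/-! ### The bilevel algorithm -/

/-- The approximate hypergradient at `x`, from approximate solutions `y` of the penalty problem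
and `z` of the lower-level problem. -/
def approxHypergrad {dx dy : ℕ} (f g : Vec dx → Vec dy → ℝ) (σ : ℝ)
    (x : Vec dx) (y z : Vec dy) : Vec dx :=
  gradX f x y + (1 / σ) • (gradX g x y - gradX g x z)

/-- The variables at the start of outer step `t`: `x_t`, the starting points `y_t^0` and `z_t^0`
of the two subroutine calls, and `a_t`. -/
structure OuterState (dx dy : ℕ) where
  x : Vec dx
  y : Vec dy
  z : Vec dy
  a : ℝ

/-- One outer step with error tolerance `ε`: the inner tolerances are `ε²`, the penalty parameter
is `ε`, and the inner calls start with step-size parameters `b0` (for `z`) and `c0` (for `y`). -/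
def outerStep {dx dy : ℕ} (f g : Vec dx → Vec dy → ℝ) (b0 c0 ε : ℝ)
    (s : OuterState dx dy) : OuterState dx dy :=
  let z' := adaOutput (g s.x) s.z b0 (ε ^ 2)
  let y' := adaOutput (penalty f g ε s.x) s.y c0 (ε ^ 2)
  let d := approxHypergrad f g ε s.x y' z'
  let a' := Real.sqrt (s.a ^ 2 + ‖d‖ ^ 2)
  { x := s.x - (1 / a') • d, y := y', z := z', a := a' }

/-- The state at the start of outer step `t`. -/
def outerState {dx dy : ℕ} (f g : Vec dx → Vec dy → ℝ) (x0 : Vec dx) (y0 z0 : Vec dy)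
    (a0 b0 c0 ε : ℝ) (t : ℕ) : OuterState dx dy :=
  (outerStep f g b0 c0 ε)^[t] { x := x0, y := y0, z := z0, a := a0 }

/-- The objective of the lower-level inner call in outer step `t`, namely `g(x_t, ·)`. -/
def objZ {dx dy : ℕ} (f g : Vec dx → Vec dy → ℝ) (x0 : Vec dx) (y0 z0 : Vec dy)
    (a0 b0 c0 ε : ℝ) (t : ℕ) : Vec dy → ℝ :=
  g (outerState f g x0 y0 z0 a0 b0 c0 ε t).x

/-- The objective of the penalty inner call in outer step `t`, namely `σ f(x_t, ·) + g(x_t, ·)`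
with `σ = ε`. -/
def objY {dx dy : ℕ} (f g : Vec dx → Vec dy → ℝ) (x0 : Vec dx) (y0 z0 : Vec dy)
    (a0 b0 c0 ε : ℝ) (t : ℕ) : Vec dy → ℝ :=
  penalty f g ε (outerState f g x0 y0 z0 a0 b0 c0 ε t).x

/-- The inner call for `z` in outer step `t` ends after finitely many iterations. -/
def endsZ {dx dy : ℕ} (f g : Vec dx → Vec dy → ℝ) (x0 : Vec dx) (y0 z0 : Vec dy)
    (a0 b0 c0 ε : ℝ) (t : ℕ) : Prop :=
  adaTerminates (objZ f g x0 y0 z0 a0 b0 c0 ε t)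
    (outerState f g x0 y0 z0 a0 b0 c0 ε t).z b0 (ε ^ 2)

/-- The inner call for `y` in outer step `t` ends after finitely many iterations. -/
def endsY {dx dy : ℕ} (f g : Vec dx → Vec dy → ℝ) (x0 : Vec dx) (y0 z0 : Vec dy)
    (a0 b0 c0 ε : ℝ) (t : ℕ) : Prop :=
  adaTerminates (objY f g x0 y0 z0 a0 b0 c0 ε t)
    (outerState f g x0 y0 z0 a0 b0 c0 ε t).y c0 (ε ^ 2)

/-- The number `K_t` of inner iterations for `z` in outer step `t`. -/
def numK {dx dy : ℕ} (f g : Vec dx → Vec dy → ℝ) (x0 : Vec dx) (y0 z0 : Vec dy)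
    (a0 b0 c0 ε : ℝ) (t : ℕ) : ℕ :=
  adaCount (objZ f g x0 y0 z0 a0 b0 c0 ε t)
    (outerState f g x0 y0 z0 a0 b0 c0 ε t).z b0 (ε ^ 2)

/-- The number `N_t` of inner iterations for `y` in outer step `t`. -/
def numN {dx dy : ℕ} (f g : Vec dx → Vec dy → ℝ) (x0 : Vec dx) (y0 z0 : Vec dy)
    (a0 b0 c0 ε : ℝ) (t : ℕ) : ℕ :=
  adaCount (objY f g x0 y0 z0 a0 b0 c0 ε t)
    (outerState f g x0 y0 z0 a0 b0 c0 ε t).y c0 (ε ^ 2)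

/-! ### The constants of the bounds -/

/-- The bound `C_φ` on the approximate hypergradient; `Cσ` is the constant in the bound
`‖∇φ_σ - ∇φ‖ ≤ Cσ σ`. -/
def Cphi (μ lf Lf Lg Cσ : ℝ) : ℝ :=
  (lf + Lg * lf / μ) + Cσ + Lf / μ + 2 * (Lg / μ)

/-- The bound `L²/μ³ · tol² + L⁴/(μ³ a0²) · Cφ²` on the optimality gap at the starting point of an
inner call, for an objective with `L`-Lipschitz gradients. -/
def warmGap (L μ a0 Cφ tol : ℝ) : ℝ :=
  L ^ 2 / μ ^ 3 * tol ^ 2 + L ^ 4 / (μ ^ 3 * a0 ^ 2) * Cφ ^ 2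

/-- The step-size threshold `max {L, β0}` (`C_b` and `C_c`). -/
def thresh (L β0 : ℝ) : ℝ := max L β0

/-- The largest step-size parameter (`b_max` and `c_max`), where `D` bounds the optimality gap at
the starting point. -/
def stepMax (L β0 D : ℝ) : ℝ :=
  thresh L β0 + 2 * (D + L / 2 * (1 + Real.log (thresh L β0 ^ 2 / β0 ^ 2)))

/-- The two-stage iteration bound, where `D` bounds the optimality gap at the starting point. -/
def iterBound (L μ β0 tol D : ℝ) : ℝ :=
  Real.log (thresh L β0 ^ 2 / β0 ^ 2) / Real.log (1 + tol ^ 2 / thresh L β0 ^ 2)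
    + stepMax L β0 D / μ *
      Real.log (L ^ 2 * (stepMax L β0 D - thresh L β0) / (μ * tol ^ 2))

/-- The optimality gap `h(y) - min h`. -/
def optGap {d : ℕ} (h : Vec d → ℝ) (y : Vec d) : ℝ := h y - ⨅ y', h y'

end BilevelAdaGrad

end

/-! ### Scalar recursions of AdaGrad-Norm -/

noncomputable section
namespace BilevelAdaGrad

/-! An inner loop is analysed through three scalar sequences (`AdaSeq`): step-size parameter `b`,
gap `Δ`, gradient norm `G`. While `b` is at most `C = max L (b 0)`, every gradient above the
tolerance multiplies `b ^ 2` by at least `1 + τ ^ 2 / C ^ 2`, which limits the length of this stage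
(`small_steps`). The gap may grow meanwhile, but only logarithmically, because the sum of `G ^ 2 / b
^ 2` telescopes against `log (b ^ 2)` (`gap_le_log`). Once `b` exceeds `C`, each step decreases the
gap by `G ^ 2 / (2 * b)`. Hence `b + 2 * Δ` no longer increases, so `b` is bounded, and the PL
inequality makes the gap decay geometrically (`gap_le_exp`). `count_le` adds up the two stages.

The outer loop only has to supply a bound on the starting gap that is uniform in `t`. A previous
inner output is nearly stationary for the previous `x`, and `x` moves by at most `Cphi / a0`, so the
new gradient, and by PL the new gap, is bounded (`optGap_le_warmGap`). The bound `Cphi` on the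
approximate hypergradient is proved directly: the PL error bound puts `y` and `z` near minimizers,
the penalty minimizer lies within `O(ε)` of the lower-level ones, and all lower-level minimizers
share the same `x`-gradient of `g` (`gradX_eq_of_minimizers`). This compensates the factor `1 / ε`.
-/

/-- The quadratic refinement of `1 + u ≤ exp u`, in the form that absorbs one extra iteration. -/
lemma mul_exp_le_add_half {P L u : ℝ} (hP : 0 ≤ P) (hL : 0 < L) (hu0 : 0 ≤ u)
    (hu : u ≤ L / (2 * (L + P))) : P * Real.exp u ≤ P + L / 2 := by
  have hLP : 0 < L + P := by linarith
  have hu1 : u * (2 * (L + P)) ≤ L := (le_div_iff₀ (by positivity)).1 hu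
  have hu2 : u ≤ 1 := by nlinarith
  have he : Real.exp u ≤ 1 + u + u ^ 2 := by
    have := Real.abs_exp_sub_one_sub_id_le (x := u) (by rw [abs_of_nonneg hu0]; exact hu2)
    linarith [(abs_le.1 this).2]
  -- The goal reduces to `(L / 2 - L * u) * (1 + u) ≤ L / 2`.
  have hPu : P * u ≤ L / 2 - L * u := by nlinarith
  have hu3 : u ≤ 1 / 2 := by nlinarith [mul_nonneg hu0 hP]
  have h4 : P * u * u ≤ (L / 2 - L * u) * u := mul_le_mul_of_nonneg_right hPu hu0
  nlinarith [mul_le_mul_of_nonneg_left he hP, mul_nonneg hL.le hu0]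

/-- The increments of the squared step-size parameter, relative to its value, sum up to at most
the increment of its logarithm. -/
lemma div_sq_le_log {b b' G : ℝ} (hb : 0 < b) (hb' : b' ^ 2 = b ^ 2 + G ^ 2) (hb0 : 0 < b') :
    G ^ 2 / b' ^ 2 ≤ Real.log (b' ^ 2) - Real.log (b ^ 2) := by
  have h1 : 0 < b ^ 2 / b' ^ 2 := by positivity
  have := Real.log_le_sub_one_of_pos h1
  rw [Real.log_div (by positivity) (by positivity)] at this
  have h2 : b ^ 2 / b' ^ 2 = 1 - G ^ 2 / b' ^ 2 := by
    field_simp; linarith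
  linarith

/-- The real sequences generated by AdaGrad-Norm: step-size parameters `b`, optimality gaps `Δ`
and gradient norms `G`, for an `L`-smooth `μ`-PL objective. -/
structure AdaSeq (L μ D : ℝ) (b Δ G : ℕ → ℝ) : Prop where
  pos : ∀ k, 0 < b k
  step : ∀ k, b (k + 1) ^ 2 = b k ^ 2 + G k ^ 2
  descent : ∀ k, Δ (k + 1) ≤ Δ k - G k ^ 2 / b (k + 1) + L / 2 * (G k ^ 2 / b (k + 1) ^ 2)
  gap_nonneg : ∀ k, 0 ≤ Δ k
  pl : ∀ k, 2 * μ * Δ k ≤ G k ^ 2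
  smooth : ∀ k, G k ^ 2 ≤ 2 * L * Δ k
  init : Δ 0 ≤ D

namespace AdaSeq

variable {L μ D : ℝ} {b Δ G : ℕ → ℝ}

lemma mono (h : AdaSeq L μ D b Δ G) : Monotone b :=
  monotone_nat_of_le_succ fun k =>
    (pow_le_pow_iff_left₀ (h.pos k).le (h.pos _).le two_ne_zero).1
      (by rw [h.step k]; nlinarith [sq_nonneg (G k)])

/-- Needs no lower bound on `b`: it controls the gap in the first stage, where the steps may be too
long for descent. -/
lemma gap_le_log (h : AdaSeq L μ D b Δ G) (hL : 0 < L) (k : ℕ) :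
    Δ k ≤ D + L / 2 * (Real.log (b k ^ 2) - Real.log (b 0 ^ 2)) := by
  induction k with
  | zero => simpa using h.init
  | succ k ih =>
    have h1 := div_sq_le_log (h.pos k) (h.step k) (h.pos (k + 1))
    have h2 : 0 ≤ G k ^ 2 / b (k + 1) := div_nonneg (sq_nonneg _) (h.pos _).le
    have h3 := h.descent k
    nlinarith [mul_le_mul_of_nonneg_left h1 (by positivity : 0 ≤ L / 2)]

/-- For `L ≤ b` the second-order term is at most half of the first-order one. -/
lemma halfDescent (h : AdaSeq L μ D b Δ G) {k : ℕ} (hk : L ≤ b (k + 1)) :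
    Δ (k + 1) ≤ Δ k - G k ^ 2 / (2 * b (k + 1)) := by
  have hb := h.pos (k + 1)
  have h1 : L / 2 * (G k ^ 2 / b (k + 1) ^ 2) ≤ b (k + 1) / 2 * (G k ^ 2 / b (k + 1) ^ 2) := by
    gcongr
  have h2 : b (k + 1) / 2 * (G k ^ 2 / b (k + 1) ^ 2) = G k ^ 2 / (2 * b (k + 1)) := by
    field_simp
  have h3 : G k ^ 2 / b (k + 1) = 2 * (G k ^ 2 / (2 * b (k + 1))) := by field_simp
  have := h.descent k
  linarith

lemma step_le (h : AdaSeq L μ D b Δ G) (k : ℕ) :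
    b (k + 1) ≤ b k + G k ^ 2 / b (k + 1) := by
  have hb := h.pos (k + 1)
  have h1 : G k ^ 2 / b (k + 1) = b (k + 1) - b k * (b k / b (k + 1)) := by
    field_simp; linarith [h.step k]
  have h2 : b k / b (k + 1) ≤ 1 := (div_le_one hb).2 (h.mono (Nat.le_succ k))
  rw [h1]
  nlinarith [h.pos k]

/-- Once the step-size parameter exceeds `L`, it grows by at most twice the optimality gap. -/
lemma le_add_gap (h : AdaSeq L μ D b Δ G) {m : ℕ} (hm : L ≤ b (m + 1)) (n : ℕ) :
    b (m + n) + 2 * Δ (m + n) ≤ b m + 2 * Δ m := by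
  induction n with
  | zero => simp
  | succ n ih =>
    have hL : L ≤ b (m + n + 1) := hm.trans (h.mono (by omega))
    have h1 := h.halfDescent hL
    have h2 := h.step_le (m + n)
    have h3 : G (m + n) ^ 2 / b (m + n + 1) = 2 * (G (m + n) ^ 2 / (2 * b (m + n + 1))) := by
      have := h.pos (m + n + 1)
      field_simp
    rw [← add_assoc]
    linarith

/-- The half descent is at least `μ * Δ / b` by PL, and `1 - u ≤ exp (-u)`. -/
lemma contraction (h : AdaSeq L μ D b Δ G) (hμ : 0 < μ) {k : ℕ} {B : ℝ} (hk : L ≤ b (k + 1))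
    (hB : b (k + 1) ≤ B) : Δ (k + 1) ≤ Real.exp (-(μ / B)) * Δ k := by
  have hb := h.pos (k + 1)
  have h1 := h.halfDescent hk
  have h2 : μ / B * Δ k ≤ G k ^ 2 / (2 * b (k + 1)) := by
    have : μ / B * Δ k ≤ μ / b (k + 1) * Δ k := by
      have := h.gap_nonneg k
      gcongr
    refine this.trans ?_
    rw [div_mul_eq_mul_div, div_le_div_iff₀ hb (by positivity)]
    nlinarith [h.pl k]
  have h3 := Real.one_sub_le_exp_neg (μ / B)
  nlinarith [mul_le_mul_of_nonneg_right h3 (h.gap_nonneg k)]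

lemma gap_le_exp (h : AdaSeq L μ D b Δ G) (hμ : 0 < μ) {m : ℕ} {B : ℝ} (hm : L ≤ b (m + 1))
    (hB : ∀ k, b k ≤ B) (n : ℕ) : Δ (m + n) ≤ Real.exp (-(n * (μ / B))) * Δ m := by
  induction n with
  | zero => simp
  | succ n ih =>
    have h1 := h.contraction hμ (hm.trans (h.mono (by omega : m + 1 ≤ m + n + 1))) (hB (m + n + 1))
    have h2 : Real.exp (-((n + 1 : ℕ) * (μ / B))) =
        Real.exp (-(μ / B)) * Real.exp (-(n * (μ / B))) := by
      rw [← Real.exp_add]; congr 1; push_cast; ring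
    rw [h2, mul_assoc]
    exact h1.trans (mul_le_mul_of_nonneg_left ih (Real.exp_pos _).le)

/-- As long as the step-size parameter stays below `C`, it grows geometrically. -/
lemma small_steps (h : AdaSeq L μ D b Δ G) {C τ : ℝ} (hτ : 0 < τ) (hC : 0 < C) {m : ℕ}
    (hm : b m ≤ C) (hG : ∀ k < m, τ < G k) :
    (m : ℝ) ≤ Real.log (C ^ 2 / b 0 ^ 2) / Real.log (1 + τ ^ 2 / C ^ 2) := by
  have hpos : 0 < τ ^ 2 / C ^ 2 := by positivity
  have hb0 := h.pos 0
  have key : ∀ k ≤ m, b 0 ^ 2 * (1 + τ ^ 2 / C ^ 2) ^ k ≤ b k ^ 2 := by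
    intro k
    induction k with
    | zero => simp
    | succ k ih =>
      intro hk
      have h1 := ih (by omega)
      have hbk : b k ≤ C := (h.mono (by omega)).trans hm
      have h2 : b k ^ 2 * (τ ^ 2 / C ^ 2) ≤ τ ^ 2 := by
        rw [mul_div_assoc', div_le_iff₀ (by positivity), mul_comm]
        have := h.pos k
        gcongr
      have h3 : τ ^ 2 ≤ G k ^ 2 := by
        have := hG k (by omega)
        gcongr
      rw [h.step k, pow_succ (1 + _), ← mul_assoc]
      nlinarith [mul_le_mul_of_nonneg_right h1 (by positivity : 0 ≤ 1 + τ ^ 2 / C ^ 2)]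
  rw [le_div_iff₀ (Real.log_pos (by linarith)), ← Real.log_pow]
  apply Real.log_le_log (by positivity)
  rw [le_div_iff₀ (by positivity), mul_comm]
  have := h.pos m
  exact (key m le_rfl).trans (by gcongr)

/-- The two-stage bound on the number of iterations with gradient norm above the tolerance. -/
lemma count_le (h : AdaSeq L μ D b Δ G) {τ : ℝ} (hτ : 0 < τ) (hμ : 0 < μ) (hμL : μ ≤ L)
    (hD : L ^ 2 / μ ^ 3 * τ ^ 2 ≤ D) {K : ℕ} (hG : ∀ k < K, τ < G k) :
    (K : ℝ) ≤ iterBound L μ (b 0) τ D := by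
  have hL : 0 < L := hμ.trans_le hμL
  have hb0 := h.pos 0
  set C := thresh L (b 0) with hCdef
  have hLC : L ≤ C := le_max_left _ _
  have hbC : b 0 ≤ C := le_max_right _ _
  have hC : 0 < C := hL.trans_le hLC
  have hlog : 0 ≤ Real.log (C ^ 2 / b 0 ^ 2) :=
    Real.log_nonneg ((one_le_div (by positivity)).2 (by gcongr))
  have hD0 : 0 ≤ D := (h.gap_nonneg 0).trans h.init
  set P := D + L / 2 * Real.log (C ^ 2 / b 0 ^ 2) with hP
  have hP0 : 0 ≤ P := by positivity
  have hB : stepMax L (b 0) D = C + 2 * P + L := by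
    rw [stepMax, ← hCdef, hP]; ring
  set B := stepMax L (b 0) D with hBdef
  have hBpos : 0 < B := by rw [hB]; positivity
  -- If `b` never passes `C`, the first term alone bounds `K`; the second must then be nonnegative.
  -- This is where the lower bound on `D` enters.
  have harg : 1 ≤ L ^ 2 * (B - C) / (μ * τ ^ 2) := by
    rw [one_le_div (by positivity)]
    have h1 : τ ^ 2 / μ ≤ D := by
      refine le_trans ?_ hD
      rw [div_mul_eq_mul_div, div_le_div_iff₀ hμ (by positivity)]
      have : μ ^ 2 ≤ L ^ 2 := by gcongr
      nlinarith [mul_le_mul_of_nonneg_right this (by positivity : 0 ≤ τ ^ 2 * μ)]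
    have h2 : τ ^ 2 ≤ D * μ := (div_le_iff₀ hμ).1 h1
    have h3 : D ≤ B - C := by
      have : 0 ≤ L / 2 * Real.log (C ^ 2 / b 0 ^ 2) := by positivity
      rw [hB]; linarith
    calc μ * τ ^ 2 ≤ μ * (D * μ) := by gcongr
      _ = μ ^ 2 * D := by ring
      _ ≤ L ^ 2 * (B - C) := by gcongr
  have hlog2 : 0 ≤ B / μ * Real.log (L ^ 2 * (B - C) / (μ * τ ^ 2)) :=
    mul_nonneg (by positivity) (Real.log_nonneg harg)
  change (K : ℝ) ≤ Real.log (C ^ 2 / b 0 ^ 2) / Real.log (1 + τ ^ 2 / C ^ 2) +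
    B / μ * Real.log (L ^ 2 * (B - C) / (μ * τ ^ 2))
  by_cases hK : b K ≤ C
  · linarith [h.small_steps hτ hC hK hG]
  have hex : ∃ k, C < b k := ⟨K, not_le.1 hK⟩
  obtain ⟨m, hm⟩ : ∃ m, Nat.find hex = m + 1 :=
    Nat.exists_eq_succ_of_ne_zero fun h0 => by
      have := Nat.find_spec hex
      rw [h0] at this
      exact absurd hbC (not_le.2 this)
  have hm1 : C < b (m + 1) := hm ▸ Nat.find_spec hex
  have hmC : b m ≤ C := not_lt.1 (Nat.find_min hex (by omega))
  have hmK : m + 1 ≤ K := hm ▸ Nat.find_min' hex (not_le.1 hK)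
  -- `m` steps stay below `C`, step `m` crosses it, and `n` more follow. Contraction is counted from
  -- `Δ m`, so the second stage has to pay for `n + 1` steps.
  obtain ⟨n, rfl⟩ : ∃ n, K = m + n + 1 := ⟨K - (m + 1), by omega⟩
  have hΔ : Δ m ≤ P := by
    refine (h.gap_le_log hL m).trans ?_
    rw [← Real.log_div (by have := h.pos m; positivity) (by positivity), hP]
    have := h.pos m
    gcongr
  have hbB : ∀ k, b k ≤ B := by
    intro k
    have h1 := h.le_add_gap (hLC.trans hm1.le) k
    have h2 := h.mono (Nat.le_add_left k m)
    have h3 := h.gap_nonneg (m + k)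
    rw [hB]; linarith
  have hexp := h.gap_le_exp hμ (hLC.trans hm1.le) hbB n
  have hτlt : τ ^ 2 < 2 * L * (Real.exp (-(n * (μ / B))) * P) := by
    have h1 : τ ^ 2 < G (m + n) ^ 2 := by
      have := hG (m + n) (by omega)
      gcongr
    refine h1.trans_le ((h.smooth _).trans ?_)
    gcongr
    exact hexp.trans (by gcongr)
  -- The extra factor `exp (μ / B)` for the crossing step is absorbed by the summand `L` in `B - C =
  -- 2 * P + L`.
  have hu : P * Real.exp (μ / B) ≤ P + L / 2 := by
    refine mul_exp_le_add_half hP0 hL (by positivity) ?_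
    apply div_le_div₀ hL.le hμL (by positivity)
    rw [hB]; linarith
  have hn : ((n : ℝ) + 1) * (μ / B) ≤ Real.log (L ^ 2 * (B - C) / (μ * τ ^ 2)) := by
    rw [Real.le_log_iff_exp_le (by linarith), le_div_iff₀ (by positivity)]
    have e1 : Real.exp ((n + 1) * (μ / B)) = Real.exp (n * (μ / B)) * Real.exp (μ / B) := by
      rw [← Real.exp_add]; ring_nf
    have e2 : Real.exp (n * (μ / B)) * Real.exp (-(n * (μ / B))) = 1 := by
      rw [← Real.exp_add]; simp
    calc Real.exp ((n + 1) * (μ / B)) * (μ * τ ^ 2)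
        ≤ Real.exp ((n + 1) * (μ / B)) * (L * (2 * L * (Real.exp (-(n * (μ / B))) * P))) := by
          gcongr
      _ = 2 * L ^ 2 * (P * Real.exp (μ / B)) := by
          rw [e1]
          linear_combination (2 * L ^ 2 * P * Real.exp (μ / B)) * e2
      _ ≤ 2 * L ^ 2 * (P + L / 2) := by gcongr
      _ = L ^ 2 * (B - C) := by rw [hB]; ring
  have hfin : (n : ℝ) + 1 ≤ B / μ * Real.log (L ^ 2 * (B - C) / (μ * τ ^ 2)) := by
    calc (n : ℝ) + 1 = B / μ * (((n : ℝ) + 1) * (μ / B)) := by field_simp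
      _ ≤ _ := by gcongr
  have hfirst := h.small_steps hτ hC hmC (fun k hk => hG k (by omega))
  push_cast
  linarith

end AdaSeq

/-! ### Order of the two-stage bound -/

/-- The constant in the order bound for the iteration count of AdaGrad-Norm. -/
def orderConst (L μ β0 D : ℝ) : ℝ :=
  Real.log (thresh L β0 ^ 2 / β0 ^ 2) * (thresh L β0 ^ 2 + 1)
    + stepMax L β0 D / μ * (L ^ 2 * (stepMax L β0 D - thresh L β0) / μ)

lemma log_thresh_nonneg {L β0 : ℝ} (hβ : 0 < β0) :
    0 ≤ Real.log (thresh L β0 ^ 2 / β0 ^ 2) := by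
  have : β0 ≤ thresh L β0 := le_max_right _ _
  exact Real.log_nonneg ((one_le_div (by positivity)).2 (by gcongr))

lemma thresh_le_stepMax {L β0 D : ℝ} (hL : 0 ≤ L) (hβ : 0 < β0) (hD : 0 ≤ D) :
    thresh L β0 ≤ stepMax L β0 D := by
  have := log_thresh_nonneg (L := L) hβ
  rw [stepMax]
  have : 0 ≤ D + L / 2 * (1 + Real.log (thresh L β0 ^ 2 / β0 ^ 2)) := by positivity
  linarith

lemma thresh_pos {L β0 : ℝ} (hβ : 0 < β0) : 0 < thresh L β0 := hβ.trans_le (le_max_right _ _)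

lemma orderConst_nonneg {L μ β0 D : ℝ} (hL : 0 ≤ L) (hμ : 0 < μ) (hβ : 0 < β0) (hD : 0 ≤ D) :
    0 ≤ orderConst L μ β0 D := by
  have h1 := log_thresh_nonneg (L := L) hβ
  have h2 := thresh_le_stepMax hL hβ hD
  have h3 := thresh_pos (L := L) hβ
  have h4 := h3.le.trans h2
  have h5 := sub_nonneg.2 h2
  unfold orderConst
  positivity

lemma iterBound_le_orderConst {L μ β0 τ D D' : ℝ} (hL : 0 ≤ L) (hμ : 0 < μ) (hβ : 0 < β0)
    (hτ : 0 < τ) (hτ1 : τ ≤ 1) (hD : 0 ≤ D) (hDD' : D ≤ D') :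
    iterBound L μ β0 τ D ≤ orderConst L μ β0 D' / τ ^ 2 := by
  have h1 := log_thresh_nonneg (L := L) hβ
  have h2 := thresh_le_stepMax hL hβ hD
  have h3 := thresh_pos (L := L) hβ
  have h4 := h3.le.trans h2
  have h5 := sub_nonneg.2 h2
  have h6 : stepMax L β0 D ≤ stepMax L β0 D' := by unfold stepMax; gcongr
  have h7 := h4.trans h6
  rw [iterBound, orderConst, add_div]
  set C := thresh L β0
  have hsq : τ ^ 2 ≤ 1 := pow_le_one₀ hτ.le hτ1
  gcongr ?_ + ?_
  · have hu : 0 < τ ^ 2 / C ^ 2 := by positivity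
    -- From `1 - 1 / (1 + u) ≤ log (1 + u)`; `τ ≤ 1` frees the denominator of `τ`.
    have hlog : τ ^ 2 / (C ^ 2 + 1) ≤ Real.log (1 + τ ^ 2 / C ^ 2) := by
      have := Real.one_sub_inv_le_log_of_pos (by linarith : 0 < 1 + τ ^ 2 / C ^ 2)
      refine le_trans ?_ this
      have : 1 - (1 + τ ^ 2 / C ^ 2)⁻¹ = τ ^ 2 / (C ^ 2 + τ ^ 2) := by
        field_simp; ring
      rw [this]
      gcongr
    calc Real.log (C ^ 2 / β0 ^ 2) / Real.log (1 + τ ^ 2 / C ^ 2)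
        ≤ Real.log (C ^ 2 / β0 ^ 2) / (τ ^ 2 / (C ^ 2 + 1)) := by gcongr
      _ = _ := by field_simp
  · have hlog : Real.log (L ^ 2 * (stepMax L β0 D - C) / (μ * τ ^ 2)) ≤
        L ^ 2 * (stepMax L β0 D - C) / (μ * τ ^ 2) :=
      (Real.log_le_self (by positivity))
    calc stepMax L β0 D / μ * Real.log (L ^ 2 * (stepMax L β0 D - C) / (μ * τ ^ 2))
        ≤ stepMax L β0 D / μ * (L ^ 2 * (stepMax L β0 D - C) / (μ * τ ^ 2)) := by gcongr
      _ ≤ stepMax L β0 D' / μ * (L ^ 2 * (stepMax L β0 D' - C) / (μ * τ ^ 2)) := by gcongr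
      _ = _ := by field_simp

end BilevelAdaGrad
end

noncomputable section
namespace BilevelAdaGrad
open Filter Topology

/-! ### Smoothness and the descent lemma -/

section Descent

variable {E : Type*} [NormedAddCommGroup E] [InnerProductSpace ℝ E] [CompleteSpace E]

lemma hasDerivAt_line {h : E → ℝ} (hd : Differentiable ℝ h) (x v : E) (s : ℝ) :
    HasDerivAt (fun s : ℝ => h (x + s • v)) (inner ℝ (gradient h (x + s • v)) v) s := by
  have h1 : HasDerivAt (fun s : ℝ => x + s • v) v s := by
    simpa using ((hasDerivAt_id s).smul_const v).const_add x
  have h2 := (hd (x + s • v)).hasFDerivAt.comp_hasDerivAt s h1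
  rwa [inner_gradient_left]

/-- The descent lemma for functions with a Lipschitz gradient. -/
lemma LipGrad.descent {L : ℝ} {h : E → ℝ} (hL : LipGrad L h) (x v : E) :
    h (x + v) ≤ h x + inner ℝ (gradient h x) v + L / 2 * ‖v‖ ^ 2 := by
  let ψ : ℝ → ℝ := fun s => h (x + s • v) - (s * inner ℝ (gradient h x) v + L / 2 * ‖v‖ ^ 2 * s ^ 2)
  have hψ : ∀ s, HasDerivAt ψ (inner ℝ (gradient h (x + s • v)) v -
      (1 * inner ℝ (gradient h x) v + L / 2 * ‖v‖ ^ 2 * (2 * s))) s := fun s => by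
    have h2 : HasDerivAt (fun s : ℝ => s ^ 2) (2 * s) s := by simpa using hasDerivAt_pow 2 s
    exact (hasDerivAt_line hL.1 x v s).sub
      (((hasDerivAt_id s).mul_const _).add (h2.const_mul _))
  have hanti : AntitoneOn ψ (Set.Icc 0 1) := by
    apply antitoneOn_of_deriv_nonpos (convex_Icc 0 1)
      (fun s _ => (hψ s).continuousAt.continuousWithinAt)
      (fun s _ => (hψ s).differentiableAt.differentiableWithinAt)
    intro s hs
    rw [interior_Icc] at hs
    rw [(hψ s).deriv]
    have h1 : inner ℝ (gradient h (x + s • v) - gradient h x) v ≤ L * (s * ‖v‖) * ‖v‖ := by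
      refine (real_inner_le_norm _ _).trans ?_
      gcongr
      refine (hL.2 _ _).trans_eq ?_
      rw [add_sub_cancel_left, norm_smul, Real.norm_of_nonneg hs.1.le]
    rw [inner_sub_left] at h1
    linarith
  have := hanti (Set.left_mem_Icc.2 zero_le_one) (Set.right_mem_Icc.2 zero_le_one) zero_le_one
  simp only [ψ, zero_smul, one_smul, add_zero] at this
  linarith

lemma LipGrad.gradient_step {L : ℝ} {h : E → ℝ} (hL : LipGrad L h) (x : E) (s : ℝ) :
    h (x - s • gradient h x) ≤ h x - s * ‖gradient h x‖ ^ 2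
      + L / 2 * (s ^ 2 * ‖gradient h x‖ ^ 2) := by
  have := hL.descent x (-(s • gradient h x))
  rw [← sub_eq_add_neg, inner_neg_right, inner_smul_right, real_inner_self_eq_norm_sq, norm_neg,
    norm_smul, mul_pow, Real.norm_eq_abs, sq_abs] at this
  linarith

lemma gradient_eq_zero_of_forall_le {h : E → ℝ} {m : E} (hm : ∀ y, h m ≤ h y) :
    gradient h m = 0 := by
  have : IsLocalMin h m := Eventually.of_forall hm
  rw [gradient, this.fderiv_eq_zero, map_zero]

/-- A gradient step of length `1 / L` cannot go below the minimum. -/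
lemma LipGrad.norm_sq_le {L : ℝ} (hL0 : 0 < L) {h : E → ℝ} (hL : LipGrad L h) {m : E}
    (hm : ∀ y, h m ≤ h y) (x : E) : ‖gradient h x‖ ^ 2 ≤ 2 * L * (h x - h m) := by
  have h1 := hL.gradient_step x (1 / L)
  have h2 := hm (x - (1 / L) • gradient h x)
  have h3 : L / 2 * ((1 / L) ^ 2 * ‖gradient h x‖ ^ 2) = 1 / L * ‖gradient h x‖ ^ 2 / 2 := by
    field_simp
  have h4 : 1 / L * ‖gradient h x‖ ^ 2 ≤ 2 * (h x - h m) := by linarith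
  rw [one_div, inv_mul_le_iff₀ hL0] at h4
  linarith

lemma LipFun.norm_gradient_le {l : ℝ} (hl : 0 ≤ l) {h : E → ℝ} (hh : LipFun l h) (x : E) :
    ‖gradient h x‖ ≤ l := by
  rw [gradient, LinearIsometryEquiv.norm_map]
  refine norm_fderiv_le_of_lipschitz ℝ (C := ⟨l, hl⟩) (LipschitzWith.of_dist_le_mul fun p q => ?_)
  rw [Real.dist_eq, dist_eq_norm]
  exact hh p q

end Descent

/-! ### The error bound for PL functions -/

lemma deriv_nonneg_of_right_min {ψ : ℝ → ℝ} {ψ' : ℝ} (hψ : HasDerivAt ψ ψ' 0)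
    (hmin : ∀ᶠ s in 𝓝[>] (0 : ℝ), ψ 0 ≤ ψ s) : 0 ≤ ψ' := by
  have h1 := (hasDerivWithinAt_iff_tendsto_slope' Set.self_notMem_Ioi).1
    (hψ.hasDerivWithinAt (s := Set.Ioi 0))
  refine ge_of_tendsto h1 ?_
  filter_upwards [hmin, self_mem_nhdsWithin] with s hs hs0
  rw [slope_def_field]
  exact div_nonneg (sub_nonneg.2 hs) (sub_nonneg.2 (le_of_lt hs0))

/-- An Ekeland-type argument: minimize `√(h - h m) + c * dist · y`, which is coercive. At a
minimizer with positive gap `a ^ 2`, the root can fall at rate at most `c`, so the gradient norm is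
at most `2 * a * c`; PL then forces `μ ≤ 2 * c ^ 2`. -/
lemma IsPL.exists_near {d : ℕ} {μ c : ℝ} {h : Vec d → ℝ} (hd : Differentiable ℝ h) {m : Vec d}
    (hm : ∀ y, h m ≤ h y) (hpl : ∀ y, 2 * μ * (h y - h m) ≤ ‖gradient h y‖ ^ 2)
    (hc : 0 < c) (hcμ : 2 * c ^ 2 < μ) (y : Vec d) :
    ∃ w, h w = h m ∧ c * dist w y ≤ Real.sqrt (h y - h m) := by
  let F : Vec d → ℝ := fun w => Real.sqrt (h w - h m) + c * dist w y
  have hF : Continuous F := by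
    have := hd.continuous
    fun_prop
  have hcoer : Tendsto F (cocompact _) atTop :=
    tendsto_atTop_mono (fun w => le_add_of_nonneg_left (Real.sqrt_nonneg _))
      ((tendsto_dist_right_cocompact_atTop y).const_mul_atTop hc)
  obtain ⟨w, hw⟩ := hF.exists_forall_le hcoer
  have hwy : c * dist w y ≤ Real.sqrt (h y - h m) := by
    have := hw y
    simp only [F, dist_self, mul_zero, add_zero] at this
    linarith [Real.sqrt_nonneg (h w - h m)]
  refine ⟨w, ?_, hwy⟩
  by_contra hne
  have hgap : 0 < h w - h m := sub_pos.2 (lt_of_le_of_ne (hm w) (Ne.symm hne))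
  set a := Real.sqrt (h w - h m) with ha
  have ha0 : 0 < a := Real.sqrt_pos.2 hgap
  have hasq : a ^ 2 = h w - h m := Real.sq_sqrt hgap.le
  -- Squaring the minimality of `w` removes the root, so that only `h` has to be differentiated,
  -- along `-∇h w`.
  have hlow : ∀ u, c * dist u w ≤ a → h w - 2 * a * c * dist u w ≤ h u := by
    intro u hu
    have h1 := hw u
    simp only [F] at h1
    have h2 : a - c * dist u w ≤ Real.sqrt (h u - h m) := by
      nlinarith [dist_triangle u w y]
    have h3 := Real.sq_sqrt (sub_nonneg.2 (hm u))
    have h4 := pow_le_pow_left₀ (sub_nonneg.2 hu) h2 2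
    nlinarith [sq_nonneg (c * dist u w)]
  set v := gradient h w with hv
  have hder := (hasDerivAt_line hd w (-v) 0).add
    ((hasDerivAt_id (0 : ℝ)).const_mul (2 * a * c * ‖v‖))
  have hnn := deriv_nonneg_of_right_min hder ?_
  · simp only [zero_smul, add_zero, inner_neg_right, ← hv, real_inner_self_eq_norm_sq,
      mul_one] at hnn
    have h5 := hpl w
    rw [← hasq, ← hv] at h5
    have hv0 : 0 < ‖v‖ ^ 2 := lt_of_lt_of_le (by have : 0 < μ := by nlinarith
                                                 positivity) h5
    have hvpos : 0 < ‖v‖ := by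
      by_contra h0
      have : ‖v‖ = 0 := le_antisymm (not_lt.1 h0) (norm_nonneg _)
      rw [this] at hv0; norm_num at hv0
    have h6 : ‖v‖ ≤ 2 * a * c := by nlinarith
    have h7 := pow_le_pow_left₀ hvpos.le h6 2
    nlinarith [mul_pos ha0 ha0]
  · have hsmall : ∀ᶠ s in 𝓝[>] (0 : ℝ), c * (s * ‖v‖) < a := by
      refine (ContinuousAt.eventually_lt (f := fun s : ℝ => c * (s * ‖v‖)) (g := fun _ => a)
        (by fun_prop) (by fun_prop) (by simpa using ha0)).filter_mono nhdsWithin_le_nhds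
    filter_upwards [hsmall, self_mem_nhdsWithin] with s hs hs0
    have hs0' : 0 < s := hs0
    have hdist : dist (w + s • -v) w = s * ‖v‖ := by
      rw [dist_eq_norm, add_sub_cancel_left, norm_smul, norm_neg, Real.norm_of_nonneg hs0'.le]
    have := hlow (w + s • -v) (by rw [hdist]; exact hs.le)
    rw [hdist] at this
    simp only [Pi.add_apply, zero_smul, add_zero, id, mul_zero]
    linarith

/-- The error bound implied by the Polyak-Łojasiewicz condition. -/
lemma IsPL.error_bound {d : ℕ} {μ : ℝ} (hμ : 0 < μ) {h : Vec d → ℝ} (hd : Differentiable ℝ h)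
    (hpl : IsPL μ h) (y : Vec d) :
    ∃ w, (∀ u, h w ≤ h u) ∧ ‖y - w‖ ≤ ‖gradient h y‖ / μ := by
  obtain ⟨m, hm, hpl⟩ := hpl
  have hclosed : IsClosed {w | h w = h m} := isClosed_eq hd.continuous continuous_const
  -- The nearest minimizer serves every `c` at once, which allows `c ^ 2` to tend to `μ / 2`.
  obtain ⟨w, hw, hdist⟩ := hclosed.exists_infDist_eq_dist ⟨m, rfl⟩ y
  have hw' : h w = h m := hw
  refine ⟨w, fun u => hw'.trans_le (hm u), ?_⟩
  have key : ∀ t, 0 < t → 2 * t < μ → t * dist y w ^ 2 ≤ h y - h m := by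
    intro t ht htμ
    obtain ⟨u, hu, hcu⟩ := IsPL.exists_near hd hm hpl (Real.sqrt_pos.2 ht)
      (by rwa [Real.sq_sqrt ht.le]) y
    have h1 : dist y w ≤ dist u y := by
      rw [← hdist, dist_comm u y]
      exact Metric.infDist_le_dist_of_mem hu
    have h2 := pow_le_pow_left₀ (by positivity) hcu 2
    rw [mul_pow, Real.sq_sqrt ht.le, Real.sq_sqrt (sub_nonneg.2 (hm y))] at h2
    exact le_trans (by gcongr) h2
  have hgrowth : μ / 2 * dist y w ^ 2 ≤ h y - h m := by
    by_contra hcon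
    rw [not_le] at hcon
    have hr : 0 < dist y w ^ 2 := by
      have := hm y
      by_contra h0
      have : dist y w ^ 2 = 0 := le_antisymm (not_lt.1 h0) (sq_nonneg _)
      rw [this] at hcon
      linarith
    have hlt : (h y - h m) / dist y w ^ 2 < μ / 2 := (div_lt_iff₀ hr).2 hcon
    obtain ⟨t, ht1, ht2⟩ := exists_between hlt
    have ht0 : 0 < t := lt_of_le_of_lt (div_nonneg (sub_nonneg.2 (hm y)) hr.le) ht1
    exact absurd (key t ht0 (by linarith)) (not_le.2 ((div_lt_iff₀ hr).1 ht1))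
  rw [le_div_iff₀ hμ, ← dist_eq_norm]
  refine (pow_le_pow_iff_left₀ (by positivity) (norm_nonneg _) two_ne_zero).1 ?_
  nlinarith [hpl y]

lemma optGap_eq {d : ℕ} {h : Vec d → ℝ} {m : Vec d} (hm : ∀ y, h m ≤ h y) (y : Vec d) :
    optGap h y = h y - h m := by
  have : ⨅ u, h u = h m :=
    le_antisymm (ciInf_le ⟨h m, by rintro _ ⟨u, rfl⟩; exact hm u⟩ m) (le_ciInf hm)
  rw [optGap, this]

lemma IsPL.optGap_le {d : ℕ} {μ : ℝ} (hμ : 0 < μ) {h : Vec d → ℝ} (hpl : IsPL μ h) (y : Vec d) :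
    optGap h y ≤ ‖gradient h y‖ ^ 2 / (2 * μ) := by
  obtain ⟨m, hm, hpl⟩ := hpl
  rw [optGap_eq hm, le_div_iff₀ (by positivity)]
  linarith [hpl y]

/-! ### Partial gradients -/

section Partial

variable {dx dy : ℕ} {g : Vec dx → Vec dy → ℝ}

lemma hasGradientAt_left (hg : Differentiable ℝ (joint g)) (x : Vec dx) (y : Vec dy) :
    HasGradientAt (fun x' => g x' y) (gradient (joint g) (WithLp.toLp 2 (x, y))).fst x := by
  rw [hasGradientAt_iff_hasFDerivAt]
  have h1 := ((WithLp.prodContinuousLinearEquiv 2 ℝ (Vec dx) (Vec dy)).symm.hasFDerivAt).comp x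
    (hasFDerivAt_prodMk_left (𝕜 := ℝ) x y)
  have h2 := (hg (WithLp.toLp 2 (x, y))).hasFDerivAt.comp x h1
  have h3 : InnerProductSpace.toDual ℝ (Vec dx) (gradient (joint g) (WithLp.toLp 2 (x, y))).fst =
      (fderiv ℝ (joint g) (WithLp.toLp 2 (x, y))).comp
        (((WithLp.prodContinuousLinearEquiv 2 ℝ (Vec dx) (Vec dy)).symm :
          Vec dx × Vec dy →L[ℝ] Pair dx dy).comp (ContinuousLinearMap.inl ℝ _ _)) := by
    refine ContinuousLinearMap.ext fun v => ?_
    change inner ℝ _ v = fderiv ℝ (joint g) (WithLp.toLp 2 (x, y)) (WithLp.toLp 2 (v, 0))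
    rw [← inner_gradient_left, WithLp.prod_inner_apply]
    simp
  rw [h3]
  exact h2

lemma hasGradientAt_right (hg : Differentiable ℝ (joint g)) (x : Vec dx) (y : Vec dy) :
    HasGradientAt (g x) (gradient (joint g) (WithLp.toLp 2 (x, y))).snd y := by
  rw [hasGradientAt_iff_hasFDerivAt]
  have h1 := ((WithLp.prodContinuousLinearEquiv 2 ℝ (Vec dx) (Vec dy)).symm.hasFDerivAt).comp y
    (hasFDerivAt_prodMk_right (𝕜 := ℝ) x y)
  have h2 := (hg (WithLp.toLp 2 (x, y))).hasFDerivAt.comp y h1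
  have h3 : InnerProductSpace.toDual ℝ (Vec dy) (gradient (joint g) (WithLp.toLp 2 (x, y))).snd =
      (fderiv ℝ (joint g) (WithLp.toLp 2 (x, y))).comp
        (((WithLp.prodContinuousLinearEquiv 2 ℝ (Vec dx) (Vec dy)).symm :
          Vec dx × Vec dy →L[ℝ] Pair dx dy).comp (ContinuousLinearMap.inr ℝ _ _)) := by
    refine ContinuousLinearMap.ext fun v => ?_
    change inner ℝ _ v = fderiv ℝ (joint g) (WithLp.toLp 2 (x, y)) (WithLp.toLp 2 (0, v))
    rw [← inner_gradient_left, WithLp.prod_inner_apply]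
    simp
  rw [h3]
  exact h2

lemma norm_gradX_le {l : ℝ} (hl : 0 ≤ l) (hg : Differentiable ℝ (joint g))
    (hlip : LipFun l (joint g)) (x : Vec dx) (y : Vec dy) : ‖gradX g x y‖ ≤ l := by
  rw [gradX, (hasGradientAt_left hg x y).gradient]
  exact (WithLp.norm_fst_le _ _).trans (hlip.norm_gradient_le hl _)

lemma norm_gradY_le {l : ℝ} (hl : 0 ≤ l) (hg : Differentiable ℝ (joint g))
    (hlip : LipFun l (joint g)) (x : Vec dx) (y : Vec dy) : ‖gradient (g x) y‖ ≤ l := by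
  rw [(hasGradientAt_right hg x y).gradient]
  exact (WithLp.norm_snd_le _ _).trans (hlip.norm_gradient_le hl _)

lemma LipGrad.gradX_sub_le {L : ℝ} (hg : LipGrad L (joint g)) (x : Vec dx) (y y' : Vec dy) :
    ‖gradX g x y - gradX g x y'‖ ≤ L * ‖y - y'‖ := by
  rw [gradX, gradX, (hasGradientAt_left hg.1 x y).gradient,
    (hasGradientAt_left hg.1 x y').gradient, ← WithLp.sub_fst]
  refine (WithLp.norm_fst_le _ _).trans ((hg.2 _ _).trans_eq ?_)
  rw [← WithLp.toLp_sub, Prod.mk_sub_mk, sub_self, WithLp.norm_toLp_snd]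

lemma LipGrad.gradY_sub_le {L : ℝ} (hg : LipGrad L (joint g)) (x x' : Vec dx) (y : Vec dy) :
    ‖gradient (g x) y - gradient (g x') y‖ ≤ L * ‖x - x'‖ := by
  rw [(hasGradientAt_right hg.1 x y).gradient,
    (hasGradientAt_right hg.1 x' y).gradient, ← WithLp.sub_snd]
  refine (WithLp.norm_snd_le _ _).trans ((hg.2 _ _).trans_eq ?_)
  rw [← WithLp.toLp_sub, Prod.mk_sub_mk, sub_self, WithLp.norm_toLp_fst]

lemma LipGrad.right {L : ℝ} (hg : LipGrad L (joint g)) (x : Vec dx) : LipGrad L (g x) := by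
  refine ⟨fun y => (hasGradientAt_right hg.1 x y).differentiableAt, fun y y' => ?_⟩
  rw [(hasGradientAt_right hg.1 x y).gradient,
    (hasGradientAt_right hg.1 x y').gradient, ← WithLp.sub_snd]
  refine (WithLp.norm_snd_le _ _).trans ((hg.2 _ _).trans_eq ?_)
  rw [← WithLp.toLp_sub, Prod.mk_sub_mk, sub_self, WithLp.norm_toLp_snd]

/-- The partial gradient in the first variable is the same at all minimizers in the second. -/
lemma gradX_eq_of_minimizers {L μ : ℝ} (hμ : 0 < μ) (hg : LipGrad L (joint g))
    (hpl : ∀ x, IsPL μ (g x)) {x : Vec dx} {z₁ z₂ : Vec dy} (h₁ : ∀ u, g x z₁ ≤ g x u)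
    (h₂ : ∀ u, g x z₂ ≤ g x u) : gradX g x z₂ = gradX g x z₁ := by
  -- At `x'` the gradient at `z₁` is at most `L * ‖x' - x‖`, so by PL the quadratic term dominates
  -- the gap of `z₁`. Hence `F` is minimal at `x`, where the quadratic has zero derivative.
  let F : Vec dx → ℝ := fun x' => g x' z₂ - g x' z₁ + L ^ 2 / (2 * μ) * ‖x' - x‖ ^ 2
  have hmin : ∀ x', F x ≤ F x' := by
    intro x'
    obtain ⟨m, hm, hplm⟩ := hpl x'
    have e0 : g x z₂ = g x z₁ := le_antisymm (h₂ _) (h₁ _)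
    have e1 : ‖gradient (g x') z₁‖ ≤ L * ‖x' - x‖ := by
      simpa [gradient_eq_zero_of_forall_le h₁] using hg.gradY_sub_le x' x z₁
    have e2 := pow_le_pow_left₀ (norm_nonneg _) e1 2
    have e3 : g x' z₁ - g x' m ≤ L ^ 2 / (2 * μ) * ‖x' - x‖ ^ 2 := by
      rw [div_mul_eq_mul_div, le_div_iff₀ (by positivity)]
      linarith [hplm z₁]
    simp only [F, e0, sub_self, norm_zero]
    have := hm z₂
    norm_num
    linarith
  have hsq : HasFDerivAt (fun x' : Vec dx => ‖x' - x‖ ^ 2) (0 : Vec dx →L[ℝ] ℝ) x := by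
    simpa using ((hasFDerivAt_id x).sub_const x).norm_sq
  have hF : HasFDerivAt F (InnerProductSpace.toDual ℝ (Vec dx) (gradX g x z₂) -
      InnerProductSpace.toDual ℝ (Vec dx) (gradX g x z₁) + (L ^ 2 / (2 * μ)) • (0 : Vec dx →L[ℝ] ℝ)) x := by
    have e (z : Vec dy) : HasFDerivAt (fun x' => g x' z)
        (InnerProductSpace.toDual ℝ (Vec dx) (gradX g x z)) x :=
      hasGradientAt_iff_hasFDerivAt.1 (hasGradientAt_left hg.1 x z).differentiableAt.hasGradientAt
    exact ((e z₂).sub (e z₁)).add (hsq.const_mul (L ^ 2 / (2 * μ)))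
  have hzero := IsLocalMin.hasFDerivAt_eq_zero (f := F) (Eventually.of_forall hmin) hF
  rw [smul_zero, add_zero, ← map_sub, map_eq_zero_iff _ (LinearIsometryEquiv.injective _),
    sub_eq_zero] at hzero
  exact hzero

end Partial

end BilevelAdaGrad
end

noncomputable section
namespace BilevelAdaGrad

/-! ### AdaGrad-Norm on PL objectives -/

section AdaGradNorm

variable {d : ℕ} {h : Vec d → ℝ} {L μ β0 τ D : ℝ} {x0 : Vec d}

lemma adaSeq_of_isPL (hL0 : 0 < L) (hL : LipGrad L h) {m : Vec d} (hm : ∀ y, h m ≤ h y)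
    (hpl : ∀ y, 2 * μ * (h y - h m) ≤ ‖gradient h y‖ ^ 2) (hβ : 0 < β0) (hD : h x0 - h m ≤ D) :
    AdaSeq L μ D (fun k => ((adaStep h)^[k] (β0, x0)).1)
      (fun k => h (adaPoint h x0 β0 k) - h m) (fun k => ‖gradient h (adaPoint h x0 β0 k)‖) := by
  have hpos : ∀ k, 0 < ((adaStep h)^[k] (β0, x0)).1 := by
    intro k
    induction k with
    | zero => exact hβ
    | succ k ih =>
      rw [Function.iterate_succ_apply', adaStep]
      exact Real.sqrt_pos.2 (by positivity)
  have hstep (k : ℕ) : adaPoint h x0 β0 (k + 1) = adaPoint h x0 β0 k -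
      (1 / ((adaStep h)^[k + 1] (β0, x0)).1) • gradient h (adaPoint h x0 β0 k) := by
    rw [adaPoint, Function.iterate_succ_apply']
    rfl
  refine ⟨hpos, fun k => ?_, fun k => ?_, fun k => sub_nonneg.2 (hm _), fun k => hpl _,
    fun k => hL.norm_sq_le hL0 hm _, hD⟩
  · simp only [Function.iterate_succ_apply']
    exact Real.sq_sqrt (by positivity)
  · have := hL.gradient_step (adaPoint h x0 β0 k) (1 / ((adaStep h)^[k + 1] (β0, x0)).1)
    rw [← hstep] at this
    linear_combination this

/-- AdaGrad-Norm on a smooth objective with the Polyak-Łojasiewicz property terminates, within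
the two-stage iteration bound. -/
lemma adaGrad_terminates_and_count_le (hμ : 0 < μ) (hμL : μ ≤ L) (hL : LipGrad L h)
    (hpl : IsPL μ h) (hβ : 0 < β0) (hτ : 0 < τ) (hD : optGap h x0 ≤ D)
    (hτD : L ^ 2 / μ ^ 3 * τ ^ 2 ≤ D) :
    adaTerminates h x0 β0 τ ∧ (adaCount h x0 β0 τ : ℝ) ≤ iterBound L μ β0 τ D := by
  obtain ⟨m, hm, hpl⟩ := hpl
  rw [optGap_eq hm] at hD
  have hs := adaSeq_of_isPL (hμ.trans_le hμL) hL hm hpl hβ hD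
  have key : ∀ K : ℕ, (∀ k < K, ¬ adaStops h x0 β0 τ k) → (K : ℝ) ≤ iterBound L μ β0 τ D :=
    fun K hK => hs.count_le hτ hμ hμL hτD fun k hk => not_le.1 (hK k hk)
  -- Every index below the `sInf` fails the test, even if the set is empty, so the count bound does
  -- not presuppose termination.
  refine ⟨?_, key _ fun k hk => Nat.notMem_of_lt_sInf hk⟩
  by_contra hnot
  obtain ⟨K, hK⟩ := exists_nat_gt (iterBound L μ β0 τ D)
  exact absurd (key K fun k _ hk => hnot ⟨k, hk⟩) (not_le.2 hK)

lemma norm_gradient_adaOutput_le (hend : adaTerminates h x0 β0 τ) :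
    ‖gradient h (adaOutput h x0 β0 τ)‖ ≤ τ :=
  Nat.sInf_mem (s := {k | adaStops h x0 β0 τ k}) hend

end AdaGradNorm

/-! ### The penalty function, warm starts and the hypergradient bound -/

section Penalty

variable {E : Type*} [NormedAddCommGroup E] [InnerProductSpace ℝ E] [CompleteSpace E]

lemma gradient_mul_add {F H : E → ℝ} (hF : Differentiable ℝ F) (hH : Differentiable ℝ H) (s : ℝ)
    (p : E) : gradient (fun q => s * F q + H q) p = s • gradient F p + gradient H p := by
  have := ((hF p).hasFDerivAt.const_mul s).add (hH p).hasFDerivAt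
  rw [gradient, gradient, gradient, ← map_smul, ← map_add]
  exact congrArg _ this.fderiv

lemma LipGrad.mul_add {F H : E → ℝ} {L₁ L₂ s : ℝ} (hF : LipGrad L₁ F) (hH : LipGrad L₂ H)
    (hs : 0 ≤ s) (hs1 : s ≤ 1) :
    LipGrad (L₁ + L₂) (fun q => s * F q + H q) := by
  refine ⟨(hF.1.const_mul s).add hH.1, fun p q => ?_⟩
  rw [gradient_mul_add hF.1 hH.1, gradient_mul_add hF.1 hH.1, add_sub_add_comm, ← smul_sub]
  refine (norm_add_le _ _).trans ?_
  rw [norm_smul, Real.norm_of_nonneg hs, add_mul]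
  refine add_le_add ?_ (hH.2 p q)
  calc s * ‖gradient F p - gradient F q‖ ≤ 1 * (L₁ * ‖p - q‖) := by
        gcongr
        exact hF.2 p q
    _ = _ := one_mul _

end Penalty

/-- Warm start: the optimality gap, at a perturbed parameter, of an approximately stationary
point. -/
lemma optGap_le_warmGap {dx dy : ℕ} {h : Vec dx → Vec dy → ℝ} {L μ a0 C τ : ℝ} (hμ : 0 < μ)
    (hμL : μ ≤ L) (hL : LipGrad L (joint h)) {x x' : Vec dx} (hpl : IsPL μ (h x')) {y : Vec dy}
    (hy : ‖gradient (h x) y‖ ≤ τ) (hx : ‖x' - x‖ ≤ C / a0) :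
    optGap (h x') y ≤ warmGap L μ a0 C τ := by
  have hL0 : 0 < L := hμ.trans_le hμL
  have h1 : ‖gradient (h x') y‖ ≤ τ + L * (C / a0) := by
    calc ‖gradient (h x') y‖ ≤ ‖gradient (h x) y‖ + ‖gradient (h x') y - gradient (h x) y‖ :=
          norm_le_norm_add_norm_sub' _ _
      _ ≤ τ + L * ‖x' - x‖ := add_le_add hy (hL.gradY_sub_le _ _ _)
      _ ≤ _ := by gcongr
  refine (hpl.optGap_le hμ y).trans ?_
  have h2 := pow_le_pow_left₀ (norm_nonneg _) h1 2
  have h3 : (τ + L * (C / a0)) ^ 2 ≤ 2 * (τ ^ 2 + L ^ 2 * (C / a0) ^ 2) := by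
    nlinarith [sq_nonneg (τ - L * (C / a0))]
  have h4 : 1 / μ ≤ L ^ 2 / μ ^ 3 := by
    rw [div_le_div_iff₀ hμ (by positivity)]
    have : μ ^ 2 ≤ L ^ 2 := by gcongr
    nlinarith
  calc ‖gradient (h x') y‖ ^ 2 / (2 * μ)
      ≤ 2 * (τ ^ 2 + L ^ 2 * (C / a0) ^ 2) / (2 * μ) := by
        gcongr
        exact h2.trans h3
    _ = 1 / μ * (τ ^ 2 + L ^ 2 * (C / a0) ^ 2) := by field_simp
    _ ≤ L ^ 2 / μ ^ 3 * (τ ^ 2 + L ^ 2 * (C / a0) ^ 2) := by gcongr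
    _ = warmGap L μ a0 C τ := by
        rw [warmGap, div_pow, mul_add]
        congr 1
        ring

namespace BasicAssumption

variable {dx dy : ℕ} {f g : Vec dx → Vec dy → ℝ} {μ lf Lf Lg ρf ρg σbar ε : ℝ}

lemma pl_lower (H : BasicAssumption f g μ lf Lf Lg ρf ρg σbar) (hσ : 0 ≤ σbar) (x : Vec dx) :
    IsPL μ (g x) := by
  have := H.pl 0 le_rfl hσ x
  rwa [show penalty f g 0 x = g x by ext y; simp [penalty]] at this

lemma lipGrad_penalty (H : BasicAssumption f g μ lf Lf Lg ρf ρg σbar) (hε : 0 ≤ ε)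
    (hε1 : ε ≤ 1) : LipGrad (Lf + Lg) (joint (penalty f g ε)) :=
  H.lipGrad_f.mul_add H.lipGrad_g hε hε1

lemma gradient_penalty (H : BasicAssumption f g μ lf Lf Lg ρf ρg σbar) (ε : ℝ) (x : Vec dx)
    (y : Vec dy) :
    gradient (penalty f g ε x) y = ε • gradient (f x) y + gradient (g x) y :=
  gradient_mul_add (H.lipGrad_f.right x).1 (H.lipGrad_g.right x).1 ε y

lemma norm_approxHypergrad_le (H : BasicAssumption f g μ lf Lf Lg ρf ρg σbar) {Cσ : ℝ}
    (hμ : 0 < μ) (hlf : 0 ≤ lf) (hLf : 0 ≤ Lf) (hLg : 0 ≤ Lg) (hCσ : 0 ≤ Cσ) (hε : 0 < ε)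
    (hε1 : ε ≤ 1) (hεσ : ε ≤ σbar) {x : Vec dx} {y z : Vec dy}
    (hy : ‖gradient (penalty f g ε x) y‖ ≤ ε ^ 2) (hz : ‖gradient (g x) z‖ ≤ ε ^ 2) :
    ‖approxHypergrad f g ε x y z‖ ≤ Cphi μ lf Lf Lg Cσ := by
  have hplg := H.pl_lower (hε.le.trans hεσ)
  have hpen := (H.lipGrad_penalty hε.le hε1).right x
  obtain ⟨y', hy', hyy⟩ := IsPL.error_bound hμ hpen.1 (H.pl ε hε.le hεσ x) y
  obtain ⟨z', hz', hzz⟩ := IsPL.error_bound hμ (H.lipGrad_g.right x).1 (hplg x) z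
  -- Stationarity of `y'` gives `∇_y g = -ε ∇_y f` there, of norm at most `ε * lf`; hence a
  -- lower-level minimizer `w` within `ε * lf / μ`.
  obtain ⟨w, hw, hyw⟩ := IsPL.error_bound hμ (H.lipGrad_g.right x).1 (hplg x) y'
  have hyy' : ‖y - y'‖ ≤ ε ^ 2 / μ := hyy.trans (by gcongr)
  have hzz' : ‖z - z'‖ ≤ ε ^ 2 / μ := hzz.trans (by gcongr)
  have hyw' : ‖y' - w‖ ≤ ε * lf / μ := by
    refine hyw.trans ?_
    gcongr
    have h0 := gradient_eq_zero_of_forall_le hy'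
    rw [H.gradient_penalty, add_comm] at h0
    rw [eq_neg_of_add_eq_zero_left h0, norm_neg, norm_smul, Real.norm_of_nonneg hε.le]
    gcongr
    exact norm_gradY_le hlf H.lipGrad_f.1 H.lip_f x y'
  have hwz := gradX_eq_of_minimizers hμ H.lipGrad_g hplg hz' hw
  -- `w` and `z'` may differ, but their `x`-gradients of `g` cancel; the remaining differences are
  -- all `O(ε)`.
  have hsplit : approxHypergrad f g ε x y z = gradX f x y' + (gradX f x y - gradX f x y') +
      (1 / ε) • ((gradX g x y - gradX g x y') + (gradX g x y' - gradX g x w)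
        - (gradX g x z - gradX g x z')) := by
    rw [approxHypergrad, hwz]
    congr 1
    · abel
    · congr 1; abel
  have b1 := norm_gradX_le hlf H.lipGrad_f.1 H.lip_f x y'
  have b2 := H.lipGrad_f.gradX_sub_le x y y'
  have b3 := H.lipGrad_g.gradX_sub_le x y y'
  have b4 := H.lipGrad_g.gradX_sub_le x y' w
  have b5 := H.lipGrad_g.gradX_sub_le x z z'
  have hε2 : ε ^ 2 ≤ 1 := pow_le_one₀ hε.le hε1
  calc ‖approxHypergrad f g ε x y z‖
      ≤ (lf + Lf * (ε ^ 2 / μ)) +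
          1 / ε * ((Lg * (ε ^ 2 / μ) + Lg * (ε * lf / μ)) + Lg * (ε ^ 2 / μ)) := by
        rw [hsplit]
        refine (norm_add_le _ _).trans (add_le_add ?_ ?_)
        · exact (norm_add_le _ _).trans (add_le_add b1 (b2.trans (by gcongr)))
        · rw [norm_smul, Real.norm_of_nonneg (by positivity)]
          gcongr
          refine (norm_sub_le _ _).trans (add_le_add ?_ (b5.trans (by gcongr)))
          exact (norm_add_le _ _).trans
            (add_le_add (b3.trans (by gcongr)) (b4.trans (by gcongr)))
    _ = lf + Lf / μ * ε ^ 2 + Lg * lf / μ + 2 * (Lg / μ) * ε := by field_simp; ring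
    _ ≤ lf + Lf / μ * 1 + Lg * lf / μ + 2 * (Lg / μ) * 1 := by gcongr
    _ ≤ Cphi μ lf Lf Lg Cσ := by rw [Cphi]; linarith

end BasicAssumption

/-! ### Outer iteration -/

section Outer

variable {dx dy : ℕ} {f g : Vec dx → Vec dy → ℝ} {x0 : Vec dx} {y0 z0 : Vec dy}
  {a0 b0 c0 ε : ℝ}

lemma outerState_succ (t : ℕ) : outerState f g x0 y0 z0 a0 b0 c0 ε (t + 1) =
    outerStep f g b0 c0 ε (outerState f g x0 y0 z0 a0 b0 c0 ε t) :=
  Function.iterate_succ_apply' _ _ _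

lemma le_outerState_a (t : ℕ) : a0 ≤ (outerState f g x0 y0 z0 a0 b0 c0 ε t).a := by
  induction t with
  | zero => exact le_rfl
  | succ t ih =>
    refine ih.trans ?_
    rw [outerState_succ, outerStep]
    exact Real.le_sqrt_of_sq_le (le_add_of_nonneg_right (sq_nonneg _))

/-- The step is the hypergradient divided by a parameter that never falls below `a0`. -/
lemma norm_outerState_x_sub_le {C : ℝ} (ha0 : 0 < a0) (t : ℕ)
    (hC : ‖approxHypergrad f g ε (outerState f g x0 y0 z0 a0 b0 c0 ε t).x
      (outerState f g x0 y0 z0 a0 b0 c0 ε (t + 1)).y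
      (outerState f g x0 y0 z0 a0 b0 c0 ε (t + 1)).z‖ ≤ C) :
    ‖(outerState f g x0 y0 z0 a0 b0 c0 ε (t + 1)).x -
      (outerState f g x0 y0 z0 a0 b0 c0 ε t).x‖ ≤ C / a0 := by
  have ha : a0 ≤ (outerState f g x0 y0 z0 a0 b0 c0 ε (t + 1)).a := le_outerState_a _
  have hx : (outerState f g x0 y0 z0 a0 b0 c0 ε (t + 1)).x =
      (outerState f g x0 y0 z0 a0 b0 c0 ε t).x -
        (1 / (outerState f g x0 y0 z0 a0 b0 c0 ε (t + 1)).a) •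
          approxHypergrad f g ε (outerState f g x0 y0 z0 a0 b0 c0 ε t).x
            (outerState f g x0 y0 z0 a0 b0 c0 ε (t + 1)).y
            (outerState f g x0 y0 z0 a0 b0 c0 ε (t + 1)).z := by
    rw [outerState_succ]
    rfl
  have ha' := ha0.trans_le ha
  rw [hx, sub_sub_cancel_left, norm_neg, norm_smul, Real.norm_of_nonneg (by positivity),
    one_div_mul_eq_div]
  exact div_le_div₀ ((norm_nonneg _).trans hC) hC ha0 ha

end Outer

lemma warmGap_mono {L μ a0 C τ τ' : ℝ} (hμ : 0 < μ) (hτ : 0 ≤ τ) (hττ : τ ≤ τ') :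
    warmGap L μ a0 C τ ≤ warmGap L μ a0 C τ' := by
  unfold warmGap
  gcongr

lemma le_warmGap {L μ a0 C τ : ℝ} (hμ : 0 < μ) : L ^ 2 / μ ^ 3 * τ ^ 2 ≤ warmGap L μ a0 C τ :=
  le_add_of_nonneg_right (by positivity)

lemma warmGap_nonneg {L μ a0 C τ : ℝ} (hμ : 0 < μ) : 0 ≤ warmGap L μ a0 C τ := by
  unfold warmGap
  positivity

end BilevelAdaGrad
end

/-! ### The main theorem -/

open BilevelAdaGrad in
theorem proposition2
    (μ lf Lf Lg ρf ρg σbar Cσ a0 b0 c0 : ℝ)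
    (hμ : 0 < μ) (hlf : 0 ≤ lf) (hLf : 0 ≤ Lf) (hμLg : μ ≤ Lg) (hρf : 0 ≤ ρf) (hρg : 0 ≤ ρg)
    (hCσ : 0 ≤ Cσ) (ha0 : 0 < a0) (hb0 : 0 < b0) (hc0 : 0 < c0) :
    -- constants of the order bounds: `M` depends on the problem constants only, and `M0`, for the
    -- initial outer step, also on the norm of an initial gradient
    ∃ (M : ℝ) (M0 : ℝ → ℝ),
      ∀ (dx dy : ℕ) (f g : Vec dx → Vec dy → ℝ),
      BasicAssumption f g μ lf Lf Lg ρf ρg σbar →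
      ∀ (x0 : Vec dx) (y0 z0 : Vec dy) (ε : ℝ),
      0 < ε → ε ≤ 1 → ε ≤ σbar → ε * ρf ≤ ρg →
      ∀ t : ℕ,
      -- both inner loops are left after finitely many iterations
      endsZ f g x0 y0 z0 a0 b0 c0 ε t ∧
      endsY f g x0 y0 z0 a0 b0 c0 ε t ∧
      -- the explicit two-stage bounds
      (1 ≤ t →
        (numK f g x0 y0 z0 a0 b0 c0 ε t : ℝ) ≤
            iterBound Lg μ b0 (ε ^ 2)
              (warmGap Lg μ a0 (Cphi μ lf Lf Lg Cσ) (ε ^ 2)) ∧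
        (numN f g x0 y0 z0 a0 b0 c0 ε t : ℝ) ≤
            iterBound (Lf + Lg) μ c0 (ε ^ 2)
              (warmGap (Lf + Lg) μ a0 (Cphi μ lf Lf Lg Cσ) (ε ^ 2))) ∧
      -- at the initial step the starting points are arbitrary, and their gaps enter
      (t = 0 →
        (numK f g x0 y0 z0 a0 b0 c0 ε t : ℝ) ≤
            iterBound Lg μ b0 (ε ^ 2)
              (max (warmGap Lg μ a0 (Cphi μ lf Lf Lg Cσ) (ε ^ 2)) (optGap (g x0) z0)) ∧
        (numN f g x0 y0 z0 a0 b0 c0 ε t : ℝ) ≤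
            iterBound (Lf + Lg) μ c0 (ε ^ 2)
              (max (warmGap (Lf + Lg) μ a0 (Cphi μ lf Lf Lg Cσ) (ε ^ 2))
                (optGap (penalty f g ε x0) y0))) ∧
      -- the orders, for the inner tolerances `ε ^ 2`
      (1 ≤ t →
        (numK f g x0 y0 z0 a0 b0 c0 ε t : ℝ) ≤ M / (ε ^ 2) ^ 2 ∧
        (numN f g x0 y0 z0 a0 b0 c0 ε t : ℝ) ≤ M / (ε ^ 2) ^ 2) ∧
      (t = 0 →
        (numK f g x0 y0 z0 a0 b0 c0 ε t : ℝ) ≤ M0 ‖gradient (g x0) z0‖ / (ε ^ 2) ^ 2 ∧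
        (numN f g x0 y0 z0 a0 b0 c0 ε t : ℝ) ≤ M0 ‖gradient (g x0) y0‖ / (ε ^ 2) ^ 2) := by
  have hLg : 0 < Lg := hμ.trans_le hμLg
  have hμLσ : μ ≤ Lf + Lg := by linarith
  have hLσ : 0 ≤ Lf + Lg := by linarith
  set C := Cphi μ lf Lf Lg Cσ with hC
  let Wz : ℝ → ℝ := warmGap Lg μ a0 C
  let Wy : ℝ → ℝ := warmGap (Lf + Lg) μ a0 C
  have hWz (τ : ℝ) : 0 ≤ Wz τ := warmGap_nonneg hμ
  have hWy (τ : ℝ) : 0 ≤ Wy τ := warmGap_nonneg hμ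
  -- The PL bound on an initial gap: the penalty gradient is at most `ε * lf + s ≤ lf + s`.
  let r (s : ℝ) : ℝ := (lf + s) ^ 2 / (2 * μ)
  have hr (s : ℝ) : 0 ≤ r s := by positivity
  refine ⟨orderConst Lg μ b0 (Wz 1) + orderConst (Lf + Lg) μ c0 (Wy 1),
    fun s => orderConst Lg μ b0 (Wz 1 + r s) + orderConst (Lf + Lg) μ c0 (Wy 1 + r s), ?_⟩
  intro dx dy f g H x0 y0 z0 ε hε hε1 hεσ _
  set S := outerState f g x0 y0 z0 a0 b0 c0 ε with hS
  have hplg := H.pl_lower (hε.le.trans hεσ)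
  have hplh := H.pl ε hε.le hεσ
  have hpen := H.lipGrad_penalty hε.le hε1
  have hτ : 0 < ε ^ 2 := by positivity
  have hτ1 : ε ^ 2 ≤ 1 := pow_le_one₀ hε.le hε1
  have adaZ (t : ℕ) (D : ℝ) (h1 : Wz (ε ^ 2) ≤ D) (h2 : optGap (g (S t).x) (S t).z ≤ D) :
      endsZ f g x0 y0 z0 a0 b0 c0 ε t ∧
        (numK f g x0 y0 z0 a0 b0 c0 ε t : ℝ) ≤ iterBound Lg μ b0 (ε ^ 2) D :=
    adaGrad_terminates_and_count_le hμ hμLg (H.lipGrad_g.right _) (hplg _) hb0 hτ h2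
      ((le_warmGap hμ).trans h1)
  have adaY (t : ℕ) (D : ℝ) (h1 : Wy (ε ^ 2) ≤ D)
      (h2 : optGap (penalty f g ε (S t).x) (S t).y ≤ D) :
      endsY f g x0 y0 z0 a0 b0 c0 ε t ∧
        (numN f g x0 y0 z0 a0 b0 c0 ε t : ℝ) ≤ iterBound (Lf + Lg) μ c0 (ε ^ 2) D :=
    adaGrad_terminates_and_count_le hμ hμLσ (hpen.right _) (hplh _) hc0 hτ h2
      ((le_warmGap hμ).trans h1)
  -- Taking for `D` the maximum with the actual gap gives termination at every `t` without
  -- induction; the uniform bounds follow from it.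
  have endZ (t : ℕ) := (adaZ t _ (le_max_left _ _) (le_max_right _ _)).1
  have endY (t : ℕ) := (adaY t _ (le_max_left _ _) (le_max_right _ _)).1
  have stopZ (t : ℕ) : ‖gradient (g (S t).x) (S (t + 1)).z‖ ≤ ε ^ 2 := by
    rw [hS, outerState_succ]
    exact norm_gradient_adaOutput_le (endZ t)
  have stopY (t : ℕ) : ‖gradient (penalty f g ε (S t).x) (S (t + 1)).y‖ ≤ ε ^ 2 := by
    rw [hS, outerState_succ]
    exact norm_gradient_adaOutput_le (endY t)
  have move (t : ℕ) : ‖(S (t + 1)).x - (S t).x‖ ≤ C / a0 :=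
    norm_outerState_x_sub_le ha0 t
      (H.norm_approxHypergrad_le hμ hlf hLf hLg.le hCσ hε hε1 hεσ (stopY t) (stopZ t))
  have warm (t : ℕ) (ht : 1 ≤ t) :
      (numK f g x0 y0 z0 a0 b0 c0 ε t : ℝ) ≤ iterBound Lg μ b0 (ε ^ 2) (Wz (ε ^ 2)) ∧
      (numN f g x0 y0 z0 a0 b0 c0 ε t : ℝ) ≤ iterBound (Lf + Lg) μ c0 (ε ^ 2) (Wy (ε ^ 2)) := by
    obtain ⟨s, rfl⟩ := Nat.exists_eq_add_of_le' ht
    exact ⟨(adaZ _ _ le_rfl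
        (optGap_le_warmGap hμ hμLg H.lipGrad_g (hplg _) (stopZ s) (move s))).2,
      (adaY _ _ le_rfl
        (optGap_le_warmGap hμ hμLσ hpen (hplh _) (stopY s) (move s))).2⟩
  have cold :
      (numK f g x0 y0 z0 a0 b0 c0 ε 0 : ℝ) ≤
        iterBound Lg μ b0 (ε ^ 2) (max (Wz (ε ^ 2)) (optGap (g x0) z0)) ∧
      (numN f g x0 y0 z0 a0 b0 c0 ε 0 : ℝ) ≤
        iterBound (Lf + Lg) μ c0 (ε ^ 2) (max (Wy (ε ^ 2)) (optGap (penalty f g ε x0) y0)) :=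
    ⟨(adaZ 0 _ (le_max_left _ _) (le_max_right _ _)).2,
      (adaY 0 _ (le_max_left _ _) (le_max_right _ _)).2⟩
  have hWz1 : Wz (ε ^ 2) ≤ Wz 1 := warmGap_mono hμ hτ.le hτ1
  have hWy1 : Wy (ε ^ 2) ≤ Wy 1 := warmGap_mono hμ hτ.le hτ1
  have gapZ : max (Wz (ε ^ 2)) (optGap (g x0) z0) ≤ Wz 1 + r ‖gradient (g x0) z0‖ := by
    refine max_le (by linarith [hr ‖gradient (g x0) z0‖]) ?_
    refine ((hplg x0).optGap_le hμ z0).trans (le_add_of_nonneg_of_le (hWz 1) ?_)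
    simp only [r]
    gcongr
    linarith
  have gapY : max (Wy (ε ^ 2)) (optGap (penalty f g ε x0) y0) ≤
      Wy 1 + r ‖gradient (g x0) y0‖ := by
    refine max_le (by linarith [hr ‖gradient (g x0) y0‖]) ?_
    refine ((hplh x0).optGap_le hμ y0).trans (le_add_of_nonneg_of_le (hWy 1) ?_)
    simp only [r]
    gcongr
    rw [H.gradient_penalty]
    refine (norm_add_le _ _).trans (add_le_add_left ?_ _)
    rw [norm_smul, Real.norm_of_nonneg hε.le]
    have h1 := norm_gradY_le hlf H.lipGrad_f.1 H.lip_f x0 y0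
    calc ε * ‖gradient (f x0) y0‖ ≤ 1 * lf := by gcongr
      _ = lf := one_mul lf
  have posZ {D : ℝ} (hD : 0 ≤ D) : 0 ≤ orderConst Lg μ b0 D := orderConst_nonneg hLg.le hμ hb0 hD
  have posY {D : ℝ} (hD : 0 ≤ D) : 0 ≤ orderConst (Lf + Lg) μ c0 D :=
    orderConst_nonneg hLσ hμ hc0 hD
  have ordZ {D D' : ℝ} (hD : 0 ≤ D) (hDD : D ≤ D') :=
    iterBound_le_orderConst hLg.le hμ hb0 hτ hτ1 hD hDD
  have ordY {D D' : ℝ} (hD : 0 ≤ D) (hDD : D ≤ D') :=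
    iterBound_le_orderConst hLσ hμ hc0 hτ hτ1 hD hDD
  intro t
  refine ⟨endZ t, endY t, warm t, ?_, fun ht => ⟨?_, ?_⟩, ?_⟩
  · rintro rfl
    exact cold
  · refine (warm t ht).1.trans ((ordZ (hWz _) hWz1).trans ?_)
    gcongr
    exact le_add_of_nonneg_right (posY (hWy 1))
  · refine (warm t ht).2.trans ((ordY (hWy _) hWy1).trans ?_)
    gcongr
    exact le_add_of_nonneg_left (posZ (hWz 1))
  · rintro rfl
    constructor
    · refine cold.1.trans ((ordZ (le_max_of_le_left (hWz _)) gapZ).trans ?_)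
      gcongr
      exact le_add_of_nonneg_right (posY (add_nonneg (hWy 1) (hr _)))
    · refine cold.2.trans ((ordY (le_max_of_le_left (hWy _)) gapY).trans ?_)
      gcongr
      exact le_add_of_nonneg_left (posZ (add_nonneg (hWz 1) (hr _)))
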